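/- Let $M$ be a smooth manifold of dimension $2n+1$ with $n\ge 1$. An almost contact complex Riemannian structure $(\varphi,\xi,\eta,g)$ on $M$ consists of a smooth field $\varphi$ of endomorphisms of $TM$, a smooth vector field $\xi$, a smooth $1$-form $\eta$ and a pseudo-Riemannian metric $g$ with $$\varphi\xi=0,\quad \varphi^2=-\mathrm{Id}+\eta\otimes\xi,\quad \eta\circ\varphi=0,\quad \eta(\xi)=1,\quad g(\varphi x,\varphi y)=-g(x,y)+\eta(x)\eta(y)$$ (the signature of $g$ is then necessarily $(n+1,n)$). Let $\nabla$ be the Levi-Civita connection of $g$ and $F(x,y,z)=g((\nabla_x\varphi)y,z)$. The structure is called Sasaki-like if, for all $X,Y,Z\in H=\ker\eta$, $$F(X,Y,Z)=F(\xi,Y,Z)=F(\xi,\xi,Z)=0,\qquad F(X,Y,\xi)=-g(X,Y).$$ **Proposition.** Let $(M,\varphi,\xi,\eta,g)$ be Sasaki-like, let $u,v,w$ be smooth real functions on $M$, and put $\overline\eta=e^{w}\eta$, $\overline\xi=e^{-w}\xi$ and $$\overline g(x,y)=e^{2u}\cos 2v\; g(x,y)+e^{2u}\sin 2v\; g(x,\varphi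 y)+(e^{2w}-e^{2u}\cos 2v)\,\eta(x)\eta(y).$$ Then $(\varphi,\overline\xi,\overline\eta,\overline g)$ is a Sasaki-like almost contact complex Riemannian structure if and only if $$dw\circ\varphi=0,\qquad du-dv\circ\varphi=0,\qquad du\circ\varphi+dv=(1-e^{w})\,\eta .$$ In that case the following hold. 1. $du(\xi)=0$ and $dv(\xi)=1-e^{w}$. 2. Suppose moreover that $w=0$. Then: * $u$ and $v$ do not depend on $\xi$, i.e. $du(\xi)=dv(\xi)=0$ and $u$, $v$ are constant along the integral curves of $\xi$; * on $H$ one has $d(u+iv)\circ\varphi=i\,d(u+iv)$; * for every complex submanifold $N$ of $M$ (an immersed complex manifold of complex dimension $n$, with $TN=H$ and complex structure $\varphi|_H$), the function $u+iv$ is holomorphic on $N$; * wherever $M$ is described as a product of such an $N$ with an interval, the slices $N\times\{t\}$ being such complex submanifolds (for the fixed complex structure of $N$) and the curves $\{y\}\times I$ being integral curves of $\xi$, the function $u+iv$ is the pull-back of a holomorphic function on $N$. -/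

import Mathlib

open scoped Manifold ContDiff Bundle
open Bundle

noncomputable section

namespace AlmostContact

section Structures

variable {E : Type*} [NormedAddCommGroup E] [NormedSpace ℝ E]
  {M : Type*} [TopologicalSpace M] [ChartedSpace E M]

/-- Fields of endomorphisms of the tangent bundle of `M`. -/
abbrev EndField (E : Type*) [NormedAddCommGroup E] [NormedSpace ℝ E]
    (M : Type*) [TopologicalSpace M] [ChartedSpace E M] : Type _ :=
  Π p : M, TangentSpace 𝓘(ℝ, E) p →L[ℝ] TangentSpace 𝓘(ℝ, E) p

/-- Vector fields on `M`. -/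
abbrev VecField (E : Type*) [NormedAddCommGroup E] [NormedSpace ℝ E]
    (M : Type*) [TopologicalSpace M] [ChartedSpace E M] : Type _ :=
  Π p : M, TangentSpace 𝓘(ℝ, E) p

/-- One-forms on `M`. -/
abbrev OneForm (E : Type*) [NormedAddCommGroup E] [NormedSpace ℝ E]
    (M : Type*) [TopologicalSpace M] [ChartedSpace E M] : Type _ :=
  Π p : M, TangentSpace 𝓘(ℝ, E) p →L[ℝ] ℝ

/-- Fields of bilinear forms on the tangent spaces of `M`. -/
abbrev BilinField (E : Type*) [NormedAddCommGroup E] [NormedSpace ℝ E]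
    (M : Type*) [TopologicalSpace M] [ChartedSpace E M] : Type _ :=
  Π p : M, TangentSpace 𝓘(ℝ, E) p →L[ℝ] TangentSpace 𝓘(ℝ, E) p →L[ℝ] ℝ

/-- `(φ, ξ, η, g)` is an almost contact complex Riemannian structure (an almost contact B-metric
structure) on `M`: the tensor fields are smooth, `(φ, ξ, η)` is an almost contact structure, and
`g` is a pseudo-Riemannian metric with `g (φ x, φ y) = - g (x, y) + η x * η y`.

No condition on the signature is needed: the identities force `g (ξ, ξ) = 1`, `ξ ⟂ ker η`, and
`φ` is a complex structure on `ker η` that is an anti-isometry of the nondegenerate form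
`g|_(ker η)`, so that in dimension `2 n + 1` the signature of `g` is `(n + 1, n)`. -/
structure IsAlmostContactComplexRiemannian [IsManifold 𝓘(ℝ, E) ∞ M]
    (φ : EndField E M) (ξ : VecField E M) (η : OneForm E M) (g : BilinField E M) : Prop where
  smooth_phi : ContMDiff 𝓘(ℝ, E) (𝓘(ℝ, E).prod 𝓘(ℝ, E →L[ℝ] E)) ∞
    (fun p ↦ TotalSpace.mk' (E →L[ℝ] E) p (φ p))
  smooth_xi : ContMDiff 𝓘(ℝ, E) (𝓘(ℝ, E).prod 𝓘(ℝ, E)) ∞ (fun p ↦ TotalSpace.mk' E p (ξ p))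
  smooth_eta : ContMDiff 𝓘(ℝ, E) (𝓘(ℝ, E).prod 𝓘(ℝ, E →L[ℝ] ℝ)) ∞
    (fun p ↦ TotalSpace.mk' (E →L[ℝ] ℝ) p (η p))
  smooth_metric : ContMDiff 𝓘(ℝ, E) (𝓘(ℝ, E).prod 𝓘(ℝ, E →L[ℝ] E →L[ℝ] ℝ)) ∞
    (fun p ↦ TotalSpace.mk' (E →L[ℝ] E →L[ℝ] ℝ) p (g p))
  phi_xi : ∀ p, φ p (ξ p) = 0
  phi_phi : ∀ p (x : TangentSpace 𝓘(ℝ, E) p), φ p (φ p x) = -x + η p x • ξ p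
  eta_phi : ∀ p (x : TangentSpace 𝓘(ℝ, E) p), η p (φ p x) = 0
  eta_xi : ∀ p, η p (ξ p) = 1
  metric_symm : ∀ p (x y : TangentSpace 𝓘(ℝ, E) p), g p x y = g p y x
  metric_nondegenerate : ∀ p (x : TangentSpace 𝓘(ℝ, E) p), (∀ y, g p x y = 0) → x = 0
  metric_compat : ∀ p (x y : TangentSpace 𝓘(ℝ, E) p),
    g p (φ p x) (φ p y) = -g p x y + η p x * η p y

/-- The connection `cov` on `TM` is a Levi-Civita connection of the field of bilinear forms `g`:
it is torsion free and `x (g (Y, Z)) = g (∇_x Y, Z) + g (Y, ∇_x Z)`. Mathlib's argument order is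
`cov Y p x = (∇_x Y) p`. -/
structure IsLeviCivita [FiniteDimensional ℝ E] [CompleteSpace E] [IsManifold 𝓘(ℝ, E) ∞ M]
    (g : BilinField E M)
    (cov : CovariantDerivative 𝓘(ℝ, E) E (TangentSpace 𝓘(ℝ, E) : M → Type _)) : Prop where
  torsion_eq_zero : cov.torsion = 0
  metric : ∀ (p : M) (Y Z : VecField E M),
    MDifferentiableAt 𝓘(ℝ, E) (𝓘(ℝ, E).prod 𝓘(ℝ, E)) (fun q ↦ TotalSpace.mk' E q (Y q)) p →
    MDifferentiableAt 𝓘(ℝ, E) (𝓘(ℝ, E).prod 𝓘(ℝ, E)) (fun q ↦ TotalSpace.mk' E q (Z q)) p →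
    ∀ x : TangentSpace 𝓘(ℝ, E) p,
      mvfderiv 𝓘(ℝ, E) (fun q ↦ g q (Y q) (Z q)) p x =
        g p (cov Y p x) (Z p) + g p (Y p) (cov Z p x)

/-- The covariant derivative `(∇_x φ) y = ∇_x (φ Y) - φ (∇_x Y)` at `p`, where `Y` is a vector
field that extends the tangent vector `y`; see `nablaEnd_eq` for the independence of `Y`. -/
def nablaEnd [IsManifold 𝓘(ℝ, E) ∞ M]
    (cov : CovariantDerivative 𝓘(ℝ, E) E (TangentSpace 𝓘(ℝ, E) : M → Type _))
    (φ : EndField E M) (p : M) (x y : TangentSpace 𝓘(ℝ, E) p) : TangentSpace 𝓘(ℝ, E) p :=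
  cov (fun q ↦ φ q (FiberBundle.extend (E := (TangentSpace 𝓘(ℝ, E) : M → Type _)) E y q)) p x -
    φ p (cov (FiberBundle.extend (E := (TangentSpace 𝓘(ℝ, E) : M → Type _)) E y) p x)

theorem nablaEnd_eq [FiniteDimensional ℝ E] [IsManifold 𝓘(ℝ, E) ∞ M]
    (cov : CovariantDerivative 𝓘(ℝ, E) E (TangentSpace 𝓘(ℝ, E) : M → Type _))
    (φ : EndField E M)
    (hφ : ContMDiff 𝓘(ℝ, E) (𝓘(ℝ, E).prod 𝓘(ℝ, E →L[ℝ] E)) ∞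
      (fun p ↦ TotalSpace.mk' (E →L[ℝ] E) p (φ p)))
    (p : M) (x : TangentSpace 𝓘(ℝ, E) p) (Y : VecField E M)
    (hY : MDifferentiableAt 𝓘(ℝ, E) (𝓘(ℝ, E).prod 𝓘(ℝ, E))
      (fun q ↦ TotalSpace.mk' E q (Y q)) p) :
    nablaEnd cov φ p x (Y p) = cov (fun q ↦ φ q (Y q)) p x - φ p (cov Y p x) := by
  have hd : ∀ Z : VecField E M, MDifferentiableAt 𝓘(ℝ, E) (𝓘(ℝ, E).prod 𝓘(ℝ, E))
      (fun q ↦ TotalSpace.mk' E q (Z q)) p →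
      MDifferentiableAt 𝓘(ℝ, E) (𝓘(ℝ, E).prod 𝓘(ℝ, E))
      (fun q ↦ TotalSpace.mk' E q (φ q (Z q))) p := fun Z hZ ↦
    MDifferentiableAt.clm_bundle_apply (F₁ := E) (F₂ := E)
      ((hφ p).mdifferentiableAt (by simp)) hZ
  have ht : TensorialAt 𝓘(ℝ, E) E
      (fun Z : VecField E M ↦ cov (fun q ↦ φ q (Z q)) p x - φ p (cov Z p x)) p := by
    constructor
    · intro f Z hf hZ
      have h1 : (fun q ↦ φ q ((f • Z) q)) = f • (fun q ↦ φ q (Z q)) := by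
        funext q; simp
      simp only [h1]
      rw [cov.isCovariantDerivativeOnUniv.leibniz hZ hf,
        cov.isCovariantDerivativeOnUniv.leibniz (hd Z hZ) hf]
      simp
      module
    · intro Z Z' hZ hZ'
      have h1 : (fun q ↦ φ q ((Z + Z') q)) = (fun q ↦ φ q (Z q)) + (fun q ↦ φ q (Z' q)) := by
        funext q; simp
      simp only [h1]
      rw [cov.isCovariantDerivativeOnUniv.add hZ hZ',
        cov.isCovariantDerivativeOnUniv.add (hd Z hZ) (hd Z' hZ')]
      simp
      module
  exact ht.pointwise (FiberBundle.mdifferentiableAt_extend ..) hY (by simp)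

/-- The structure tensor `F (x, y, z) = g ((∇_x φ) y, z)`. -/
def structureTensor [IsManifold 𝓘(ℝ, E) ∞ M]
    (cov : CovariantDerivative 𝓘(ℝ, E) E (TangentSpace 𝓘(ℝ, E) : M → Type _))
    (φ : EndField E M) (g : BilinField E M) (p : M) (x y z : TangentSpace 𝓘(ℝ, E) p) : ℝ :=
  g p (nablaEnd cov φ p x y) z

/-- `(φ, ξ, η, g)` is a Sasaki-like almost contact complex Riemannian structure: with the
Levi-Civita connection of `g`, and for horizontal `X`, `Y`, `Z` (in the kernel of `η`),
`F (X, Y, Z) = F (ξ, Y, Z) = F (ξ, ξ, Z) = 0` and `F (X, Y, ξ) = - g (X, Y)`. -/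
def IsSasakiLike [FiniteDimensional ℝ E] [CompleteSpace E] [IsManifold 𝓘(ℝ, E) ∞ M]
    (φ : EndField E M) (ξ : VecField E M) (η : OneForm E M) (g : BilinField E M) : Prop :=
  IsAlmostContactComplexRiemannian φ ξ η g ∧
    ∃ cov : CovariantDerivative 𝓘(ℝ, E) E (TangentSpace 𝓘(ℝ, E) : M → Type _),
      IsLeviCivita g cov ∧
      ∀ (p : M) (X Y Z : TangentSpace 𝓘(ℝ, E) p), η p X = 0 → η p Y = 0 → η p Z = 0 →
        structureTensor cov φ g p X Y Z = 0 ∧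
        structureTensor cov φ g p (ξ p) Y Z = 0 ∧
        structureTensor cov φ g p (ξ p) (ξ p) Z = 0 ∧
        structureTensor cov φ g p X Y (ξ p) = -g p X Y

/-! Contact conformal transformations. -/

/-- `e^w η`. -/
def confEta (η : OneForm E M) (w : M → ℝ) : OneForm E M := fun p ↦ Real.exp (w p) • η p

/-- `e^(-w) ξ`. -/
def confXi (ξ : VecField E M) (w : M → ℝ) : VecField E M := fun p ↦ Real.exp (-w p) • ξ p

/-- `e^(2u) cos(2v) g(x, y) + e^(2u) sin(2v) g(x, φ y) + (e^(2w) - e^(2u) cos(2v)) η(x) η(y)`. -/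
def confMetric (φ : EndField E M) (η : OneForm E M) (g : BilinField E M) (u v w : M → ℝ) :
    BilinField E M := fun p ↦
  (Real.exp (2 * u p) * Real.cos (2 * v p)) • g p
    + (Real.exp (2 * u p) * Real.sin (2 * v p)) •
      (ContinuousLinearMap.precomp ℝ (φ p)).comp (g p)
    + (Real.exp (2 * w p) - Real.exp (2 * u p) * Real.cos (2 * v p)) • (η p).smulRight (η p)

theorem confMetric_apply (φ : EndField E M) (η : OneForm E M) (g : BilinField E M)
    (u v w : M → ℝ) (p : M) (x y : TangentSpace 𝓘(ℝ, E) p) :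
    confMetric φ η g u v w p x y =
      Real.exp (2 * u p) * Real.cos (2 * v p) * g p x y
        + Real.exp (2 * u p) * Real.sin (2 * v p) * g p x (φ p y)
        + (Real.exp (2 * w p) - Real.exp (2 * u p) * Real.cos (2 * v p)) * (η p x * η p y) :=
  rfl

/-- The complex manifold `N` (modelled on the complex vector space `G`), with the smooth immersion
`ι : N → M`, is an integral submanifold of the horizontal distribution `ker η` whose complex
structure is the restriction of `φ`. The real tangent spaces of `N` are those of the underlying
real manifold, on which the complex structure is the multiplication by `i` in `G`. -/
structure IsHorizontalComplexLeaf {G : Type*} [NormedAddCommGroup G] [NormedSpace ℂ G]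
    {N : Type*} [TopologicalSpace N] [ChartedSpace G N]
    (φ : EndField E M) (η : OneForm E M) (ι : N → M) : Prop where
  smooth : ContMDiff 𝓘(ℝ, G) 𝓘(ℝ, E) ∞ ι
  immersion : ∀ y : N, Function.Injective (mfderiv 𝓘(ℝ, G) 𝓘(ℝ, E) ι y)
  tangent : ∀ y : N, Set.range (mfderiv 𝓘(ℝ, G) 𝓘(ℝ, E) ι y) = {x | η (ι y) x = 0}
  complex : ∀ (y : N) (X : G), mfderiv 𝓘(ℝ, G) 𝓘(ℝ, E) ι y (Complex.I • X : G) =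
    φ (ι y) (mfderiv 𝓘(ℝ, G) 𝓘(ℝ, E) ι y X)

end Structures

end AlmostContact

end

/-! The compatibility identity makes `φ` self-adjoint for `g` and gives `η = g(·, ξ)`. Hence `∇_x φ`
is self-adjoint and `F(x, ξ, ξ) = 0`. With these symmetries, the Sasaki-like conditions become one
tensor equation, `(∇_x φ) y = -g(x, y) ξ - η(y) x + 2 η(x) η(y) ξ` (`sasaki_conditions_iff`), which
also forces `∇_x ξ = -φ x` (`cov_xi`).

Write the new metric as `k = a g + b g(·, φ ·) + c η ⊗ η`, where `a + ib = e^(2(u + iv))`, `W = e^w`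
and `c = W² - a`. The equations for `∇φ` and `∇ξ` express `∇k` through `da`, `db`, `dc` and the
structure tensors (`mvfderiv_conformal`). A connection `∇ + D` is Levi-Civita for `k` exactly when
`D` is symmetric and compensates `∇k`. This condition is pointwise, and the Koszul formula solves
it.

What remains is linear algebra on one tangent space (`sasakiTensor_conformal_iff`). Put `α = du ∘ φ
+ dv - (1 - W) η` and `β = du - dv ∘ φ`. Paired with `k`, the defect of the new Sasaki-like equation
involves only `dw ∘ φ` and the real and imaginary parts of `2 (a + ib)(α - iβ)`. Since `a + ib ≠ 0`,
the defect vanishes exactly when `dw ∘ φ`, `α` and `β` do.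

Evaluating these equations at `ξ` gives the derivatives along `ξ`. For `w = 0` their restriction to
`ker η` is the Cauchy-Riemann system for `u + iv`, with `φ` as complex structure. -/

noncomputable section
namespace AlmostContact

/-! ### Linear algebra on one tangent space. -/

section Algebra

variable {V : Type*} [AddCommGroup V] [Module ℝ V] [TopologicalSpace V]

/-- The algebraic identities of an almost contact complex Riemannian structure on one tangent
space. -/
structure IsContactModel (φ : V →L[ℝ] V) (ξ : V) (η : V →L[ℝ] ℝ) (g : V →L[ℝ] V →L[ℝ] ℝ) :
    Prop where
  phi_xi : φ ξ = 0
  phi_phi : ∀ x, φ (φ x) = -x + η x • ξ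
  eta_phi : ∀ x, η (φ x) = 0
  eta_xi : η ξ = 1
  symm : ∀ x y, g x y = g y x
  nondegenerate : ∀ x, (∀ y, g x y = 0) → x = 0
  compat : ∀ x y, g (φ x) (φ y) = -g x y + η x * η y

/-- The value `-g(x, y) ξ - η(y) x + 2 η(x) η(y) ξ` of `(∇_x φ) y` on a Sasaki-like manifold. -/
def sasakiTensor (ξ : V) (η : V →L[ℝ] ℝ) (g : V →L[ℝ] V →L[ℝ] ℝ) (x y : V) : V :=
  -(g x y • ξ) - η y • x + (2 * η x * η y) • ξ

namespace IsContactModel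

variable {φ : V →L[ℝ] V} {ξ : V} {η : V →L[ℝ] ℝ} {g : V →L[ℝ] V →L[ℝ] ℝ}

section Basic

variable (h : IsContactModel φ ξ η g)
include h

/-- Taking `y = ξ` in the compatibility identity kills its left side. This is what later allows `η`
to be differentiated as `g(·, ξ)`. -/
theorem metric_xi (x : V) : g x ξ = η x := by
  have := h.compat x ξ
  rw [h.phi_xi, h.eta_xi] at this
  simp at this
  linarith

theorem xi_metric (x : V) : g ξ x = η x := by rw [h.symm, h.metric_xi]

/-- An anti-isometry with square `-1` on `ker η` is self-adjoint: replace `y` by `φ y` in the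
compatibility identity. -/
theorem metric_phi_left (x y : V) : g (φ x) y = g x (φ y) := by
  have := h.compat x (φ y)
  rw [h.phi_phi, h.eta_phi] at this
  simp [h.metric_xi, h.eta_phi] at this
  linarith

theorem metric_phi_symm (x y : V) : g x (φ y) = g y (φ x) := by
  rw [← h.metric_phi_left, h.symm]

theorem eq_of_metric_eq {x y : V} (H : ∀ z, g x z = g y z) : x = y := by
  rw [← sub_eq_zero]
  exact h.nondegenerate _ fun z ↦ by simp [H z]

theorem eta_sub_xi (x : V) : η (x - η x • ξ) = 0 := by simp [h.eta_xi]

/-- The vectors `y` and `φ y` are linearly independent for horizontal `y ≠ 0`. -/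
theorem eq_zero_of_smul_add_smul_phi {y : V} (hy : η y = 0) (hy0 : y ≠ 0) {α β : ℝ}
    (H : α • y + β • φ y = 0) : α = 0 ∧ β = 0 := by
  -- `φ` acts as `i` on horizontal vectors, so the relation says `(α + iβ) y = 0`; multiplying by
  -- the conjugate gives `(α² + β²) y = 0`.
  have h1 : α • φ y - β • y = 0 := by
    have := congrArg φ H
    simp [h.phi_phi, hy] at this
    rw [← this]; module
  have h2 : (α ^ 2 + β ^ 2) • y = 0 := by
    have : (α ^ 2 + β ^ 2) • y = α • (α • y + β • φ y) - β • (α • φ y - β • y) := by module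
    rw [this, H, h1]; simp
  rcases smul_eq_zero.1 h2 with h3 | h3
  · constructor <;> nlinarith [sq_nonneg α, sq_nonneg β]
  · exact absurd h3 hy0

/-- The Sasaki-like conditions on a tensor with the symmetries of the structure tensor determine
the tensor. -/
theorem sasaki_conditions_iff (N : V → V → V)
    (hadd : ∀ x x' y, N (x + x') y = N x y + N x' y)
    (hsmul : ∀ (c : ℝ) x y, N (c • x) y = c • N x y)
    (hsymm : ∀ x y z, g (N x y) z = g (N x z) y) (hxi : ∀ x, g (N x ξ) ξ = 0) :
    (∀ X Y Z, η X = 0 → η Y = 0 → η Z = 0 →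
      g (N X Y) Z = 0 ∧ g (N ξ Y) Z = 0 ∧ g (N ξ ξ) Z = 0 ∧ g (N X Y) ξ = -g X Y) ↔
    ∀ x y, N x y = sasakiTensor ξ η g x y := by
  constructor
  · intro H x y
    refine h.eq_of_metric_eq fun z ↦ ?_
    -- `N` is not assumed linear in its second argument; `hsymm` moves that argument into the linear
    -- slot of `g`. The `r s` term drops out by `hxi`.
    have hN : ∀ x a b : V, ∀ r s : ℝ, g (N x (a + r • ξ)) (b + s • ξ) =
        g (N x a) b + s * g (N x a) ξ + r * g (N x b) ξ := by
      intro x a b r s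
      rw [map_add, map_smul, hsymm x _ b, hsymm x _ ξ]
      simp only [map_add, map_smul, hxi, smul_eq_mul]
      rw [hsymm x b a, hsymm x ξ a]
      ring
    have hx : x = (x - η x • ξ) + η x • ξ := by abel
    have hy : y = (y - η y • ξ) + η y • ξ := by abel
    have hz : z = (z - η z • ξ) + η z • ξ := by abel
    have key : g (N x y) z = -(g x y - η x * η y) * η z - (g x z - η x * η z) * η y := by
      conv_lhs => rw [hy, hz, hN]
      set Y := y - η y • ξ with hY
      set Z := z - η z • ξ with hZ
      set X := x - η x • ξ with hX
      have hX0 : η X = 0 := h.eta_sub_xi x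
      have hY0 : η Y = 0 := h.eta_sub_xi y
      have hZ0 : η Z = 0 := h.eta_sub_xi z
      have e : ∀ b, N x b = N X b + η x • N ξ b := by
        intro b
        conv_lhs => rw [hx]
        rw [hadd, hsmul]
      have e1 := H X Y Z hX0 hY0 hZ0
      have e2 := H X Z Y hX0 hZ0 hY0
      have e3 : ∀ B, η B = 0 → g (N ξ B) ξ = 0 := fun B hB ↦ by
        rw [hsymm]; exact (H X Y B hX0 hY0 hB).2.2.1
      rw [e, e]
      simp only [map_add, map_smul, _root_.add_apply, _root_.smul_apply,
        smul_eq_mul, e1.1, e1.2.1, e1.2.2.2, e2.2.2.2, e3 Y hY0, e3 Z hZ0]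
      have gXY : g X Y = g x y - η x * η y := by
        simp [hX, hY, h.metric_xi, h.xi_metric, h.eta_xi, mul_comm]
      have gXZ : g X Z = g x z - η x * η z := by
        simp [hX, hZ, h.metric_xi, h.xi_metric, h.eta_xi, mul_comm]
      rw [gXY, gXZ]; ring
    rw [key, sasakiTensor]
    simp only [map_add, map_sub, map_neg, map_smul, _root_.add_apply,
      _root_.sub_apply, _root_.neg_apply,
      _root_.smul_apply, smul_eq_mul, h.xi_metric]
    ring
  · intro H X Y Z hX hY hZ
    simp [H, sasakiTensor, hX, hY, hZ, h.xi_metric, h.eta_xi]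

end Basic

/-- Contact conformal transformations preserve the algebraic identities. -/
theorem conformal (h : IsContactModel φ ξ η g) {a b W : ℝ} (hab : a ^ 2 + b ^ 2 ≠ 0) (hW : W ≠ 0)
    {k : V →L[ℝ] V →L[ℝ] ℝ}
    (hk : ∀ x y, k x y = a * g x y + b * g x (φ y) + (W ^ 2 - a) * (η x * η y)) :
    IsContactModel φ (W⁻¹ • ξ) (W • η) k where
  phi_xi := by simp [h.phi_xi]
  phi_phi x := by
    rw [h.phi_phi, _root_.smul_apply, smul_smul, smul_eq_mul]
    congr 2
    field_simp
  eta_phi x := by simp [h.eta_phi]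
  eta_xi := by simp [h.eta_xi, hW]
  symm x y := by rw [hk, hk, h.symm x y, h.metric_phi_symm x y]; ring
  nondegenerate x H := by
    -- `k` is `g` preceded by an operator that multiplies the `ξ`-component by `W²` and acts on `ker
    -- η` as `a + bφ`; both are injective.
    have e : ∀ z, g (a • x + b • φ x + ((W ^ 2 - a) * η x) • ξ) z = k x z := by
      intro z
      rw [hk, ← h.metric_phi_left]
      simp [h.xi_metric]
      ring
    have e0 := h.nondegenerate _ fun z ↦ (e z).trans (H z)
    have e1 := congrArg η e0
    simp [h.eta_phi, h.eta_xi] at e1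
    have hx : η x = 0 := by
      have : W ^ 2 * η x = 0 := by linarith
      simpa [hW] using this
    by_contra hx0
    rw [hx] at e0
    have := h.eq_zero_of_smul_add_smul_phi hx hx0 (α := a) (β := b) (by simpa using e0)
    exact hab (by simp [this.1, this.2])
  compat x y := by
    rw [hk, hk, h.compat, h.phi_phi]
    simp [h.metric_phi_left, h.eta_phi, h.phi_xi]
    ring

end IsContactModel

end Algebra

/-! ### The difference tensor and the pointwise form of the equivalence. -/

section ConformalAlgebra

variable {V : Type*} [AddCommGroup V] [Module ℝ V] [TopologicalSpace V]

/-- The derivative `(∇_x k)(y, z)` of `k = a g + b g(·, φ ·) + c η ⊗ η` on a Sasaki-like manifold,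
in terms of the differentials `da`, `db`, `dc` of the coefficients. -/
def confDeriv (φ : V →L[ℝ] V) (ξ : V) (η : V →L[ℝ] ℝ) (g : V →L[ℝ] V →L[ℝ] ℝ) (b c : ℝ)
    (da db dc : V →L[ℝ] ℝ) (x y z : V) : ℝ :=
  da x * g y z + db x * g y (φ z) + b * g y (sasakiTensor ξ η g x z) + dc x * (η y * η z) -
    c * (g (φ x) y * η z + η y * g (φ x) z)

/-- A trilinear form `K` is represented by a bilinear map through a nondegenerate form. -/
theorem exists_bilinear_of_nondegenerate [IsTopologicalAddGroup V] [ContinuousSMul ℝ V]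
    [FiniteDimensional ℝ V] [T2Space V]
    (k : V →L[ℝ] V →L[ℝ] ℝ) (hk : ∀ x, (∀ y, k x y = 0) → x = 0) (K : V → V → V → ℝ)
    (hadd₁ : ∀ x x' y z, K (x + x') y z = K x y z + K x' y z)
    (hsmul₁ : ∀ (c : ℝ) x y z, K (c • x) y z = c * K x y z)
    (hadd₂ : ∀ x y y' z, K x (y + y') z = K x y z + K x y' z)
    (hsmul₂ : ∀ (c : ℝ) x y z, K x (c • y) z = c * K x y z)
    (hadd₃ : ∀ x y z z', K x y (z + z') = K x y z + K x y z')
    (hsmul₃ : ∀ (c : ℝ) x y z, K x y (c • z) = c * K x y z) :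
    ∃ D : V →L[ℝ] V →L[ℝ] V, ∀ x y z, k (D x y) z = K x y z := by
  let B : V →ₗ[ℝ] Module.Dual ℝ V :=
    { toFun := fun x ↦ (k x).toLinearMap
      map_add' := fun x y ↦ by ext; simp
      map_smul' := fun c x ↦ by ext; simp }
  have hB : ∀ x z, B x z = k x z := fun _ _ ↦ rfl
  have hinj : Function.Injective B := by
    rw [← LinearMap.ker_eq_bot, LinearMap.ker_eq_bot']
    intro x hx
    exact hk x fun y ↦ by rw [← hB, hx]; rfl
  have hsurj : Function.Surjective B :=
    (LinearMap.injective_iff_surjective_of_finrank_eq_finrank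
      (Subspace.dual_finrank_eq (K := ℝ) (V := V)).symm).1 hinj
  have hex : ∀ x y, ∃ d, ∀ z, k d z = K x y z := fun x y ↦ by
    obtain ⟨d, hd⟩ := hsurj
      { toFun := K x y, map_add' := hadd₃ x y, map_smul' := fun c z ↦ hsmul₃ c x y z }
    exact ⟨d, fun z ↦ by rw [← hB, hd]; rfl⟩
  choose D hD using hex
  have hext : ∀ x y, (∀ z, k x z = k y z) → x = y := fun x y H ↦
    hinj (LinearMap.ext H)
  refine ⟨(LinearMap.mk₂ ℝ D (fun x x' y ↦ hext _ _ fun z ↦ ?_) (fun c x y ↦ hext _ _ fun z ↦ ?_)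
    (fun x y y' ↦ hext _ _ fun z ↦ ?_) (fun c x y ↦ hext _ _ fun z ↦ ?_)).toContinuousBilinearMap,
    fun x y z ↦ hD x y z⟩
  · simp [hD, hadd₁]
  · simp [hD, hsmul₁]
  · simp [hD, hadd₂]
  · simp [hD, hsmul₂]

namespace IsContactModel

variable {φ : V →L[ℝ] V} {ξ : V} {η : V →L[ℝ] ℝ} {g : V →L[ℝ] V →L[ℝ] ℝ}

theorem metric_sasakiTensor (h : IsContactModel φ ξ η g) (x y z : V) :
    g z (sasakiTensor ξ η g x y) = -g x y * η z - η y * g x z + 2 * η x * η y * η z := by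
  simp [sasakiTensor, h.metric_xi, h.symm z x]

theorem confDeriv_symm (h : IsContactModel φ ξ η g) (b c : ℝ) (da db dc : V →L[ℝ] ℝ)
    (x y z : V) :
    confDeriv φ ξ η g b c da db dc x y z = confDeriv φ ξ η g b c da db dc x z y := by
  simp only [confDeriv, h.metric_sasakiTensor, h.symm y z, h.metric_phi_symm y z]
  ring

/-- The existence part of the fundamental lemma for the form `k`, relative to a connection with
`∇ k = confDeriv`. -/
theorem exists_difference [IsTopologicalAddGroup V] [ContinuousSMul ℝ V]
    [FiniteDimensional ℝ V] [T2Space V] (h : IsContactModel φ ξ η g)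
    {k : V →L[ℝ] V →L[ℝ] ℝ} (hk : ∀ x, (∀ y, k x y = 0) → x = 0) (hks : ∀ x y, k x y = k y x)
    (b c : ℝ) (da db dc : V →L[ℝ] ℝ) :
    ∃ D : V →L[ℝ] V →L[ℝ] V, (∀ x y, D x y = D y x) ∧
      ∀ x y z, k (D y x) z + k y (D z x) = confDeriv φ ξ η g b c da db dc x y z := by
  set T := confDeriv φ ξ η g b c da db dc with hT
  have Ts : ∀ x y z, T x y z = T x z y := h.confDeriv_symm b c da db dc
  -- The trilinear form is half of the Koszul combination of `T`; symmetry of `T` in its last two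
  -- arguments makes `D` symmetric.
  obtain ⟨D, hD⟩ := exists_bilinear_of_nondegenerate k hk
    (fun y x z ↦ (T x y z + T y x z - T z x y) / 2)
    (fun x x' y z ↦ by simp [hT, confDeriv, sasakiTensor]; ring)
    (fun x x' y z ↦ by simp [hT, confDeriv, sasakiTensor]; ring)
    (fun x x' y z ↦ by simp [hT, confDeriv, sasakiTensor]; ring)
    (fun x x' y z ↦ by simp [hT, confDeriv, sasakiTensor]; ring)
    (fun x x' y z ↦ by simp [hT, confDeriv, sasakiTensor]; ring)
    (fun x x' y z ↦ by simp [hT, confDeriv, sasakiTensor]; ring)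
  refine ⟨D, fun x y ↦ sub_eq_zero.1 (hk _ fun z ↦ ?_), fun x y z ↦ ?_⟩
  · rw [map_sub, _root_.sub_apply, hD, hD, Ts z x y]
    ring
  · rw [hks y, hD, hD, Ts x z y]
    ring

/-- The Sasaki-like condition for the conformally transformed structure at a point, where `D` is
the difference of the Levi-Civita connections. -/
theorem sasakiTensor_conformal_iff [IsTopologicalAddGroup V] [ContinuousSMul ℝ V]
    (h : IsContactModel φ ξ η g) (hY : ∃ Y, η Y = 0 ∧ Y ≠ 0)
    {a b W : ℝ} (hab : a ^ 2 + b ^ 2 ≠ 0) (hW : W ≠ 0)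
    {k : V →L[ℝ] V →L[ℝ] ℝ}
    (hk : ∀ x y, k x y = a * g x y + b * g x (φ y) + (W ^ 2 - a) * (η x * η y))
    {du dv dw da db dc : V →L[ℝ] ℝ}
    (hda : ∀ x, da x = 2 * a * du x - 2 * b * dv x) (hdb : ∀ x, db x = 2 * b * du x + 2 * a * dv x)
    (hdc : ∀ x, dc x = 2 * W ^ 2 * dw x - da x)
    {D : V →L[ℝ] V →L[ℝ] V} (hDs : ∀ x y, D x y = D y x)
    (hD : ∀ x y z, k (D y x) z + k y (D z x) = confDeriv φ ξ η g b (W ^ 2 - a) da db dc x y z) :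
    (∀ x y, sasakiTensor ξ η g x y + D (φ y) x - φ (D y x) =
      sasakiTensor (W⁻¹ • ξ) (W • η) k x y) ↔
    ∀ x, dw (φ x) = 0 ∧ du x - dv (φ x) = 0 ∧ du (φ x) + dv x = (1 - W) * η x := by
  have hK := h.conformal hab hW hk
  set T := confDeriv φ ξ η g b (W ^ 2 - a) da db dc with hT
  have koszul : ∀ x y z, 2 * k (D y x) z = T x y z + T y x z - T z x y := by
    intro x y z
    rw [← hD x y z, ← hD y x z, ← hD z x y, hDs x y, hDs x z, hDs z y, hK.symm y (D z x)]
    ring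
  -- `P + iQ = 2 (a + ib)(α - iβ)`, with `α = du ∘ φ + dv - (1 - W) η` and `β = du - dv ∘ φ`.
  set P : V → ℝ := fun y ↦ 2 * a * (du (φ y) + dv y - (1 - W) * η y) +
    2 * b * (du y - dv (φ y)) with hP
  set Q : V → ℝ := fun y ↦ 2 * b * (du (φ y) + dv y - (1 - W) * η y) -
    2 * a * (du y - dv (φ y)) with hQ
  have hkξ : ∀ z, k ξ z = W ^ 2 * η z := fun z ↦ by
    rw [hk, ← h.metric_phi_left, h.phi_xi, h.xi_metric, h.eta_xi]; simp; ring
  have key : ∀ x y z, 2 * k (sasakiTensor ξ η g x y + D (φ y) x - φ (D y x) -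
      sasakiTensor (W⁻¹ • ξ) (W • η) k x y) z =
      P y * (g x z - η x * η z) + Q y * g x (φ z) + (P z * (g x y - η x * η y) + Q z * g x (φ y)) +
        2 * W ^ 2 * η x * (dw (φ y) * η z + dw (φ z) * η y) := by
    intro x y z
    have e1 := koszul x (φ y) z
    -- `φ` is self-adjoint for `k` too, so `k(φ(D y x), z)` is the Koszul expression at `φ z`.
    have e2 := koszul x y (φ z)
    have e3 : k (sasakiTensor ξ η g x y) z =
        -(g x y * (W ^ 2 * η z)) - η y * k x z + 2 * η x * η y * (W ^ 2 * η z) := by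
      simp [sasakiTensor, hkξ]
    have e4 : k (sasakiTensor (W⁻¹ • ξ) (W • η) k x y) z =
        -(k x y * (W * η z)) - W * η y * k x z + 2 * η x * η y * (W ^ 3 * η z) := by
      simp [sasakiTensor, hkξ]
      field_simp
    simp only [map_add, map_sub, _root_.add_apply, _root_.sub_apply, hK.metric_phi_left]
    rw [e3, e4]
    have e5 : 2 * k (D (φ y) x) z - 2 * k (D y x) (φ z) = T x (φ y) z + T (φ y) x z - T z x (φ y)
      - (T x y (φ z) + T y x (φ z) - T (φ z) x y) := by rw [e1, e2]
    simp only [hT, confDeriv, h.metric_sasakiTensor, h.metric_phi_left,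
      h.eta_phi, h.phi_phi, map_add, map_neg, map_smul, smul_eq_mul, h.metric_xi,
      _root_.add_apply, _root_.neg_apply, _root_.smul_apply, h.xi_metric,
      h.symm y x, h.symm z x, h.symm z y, h.metric_phi_symm y x, h.metric_phi_symm z x,
      h.metric_phi_symm z y, hdc] at e5
    simp only [hk x y, hk x z, hP, hQ]
    simp only [hda, hdb] at e5 ⊢
    linear_combination e5
  constructor
  · intro H
    have G0 : ∀ x y z, P y * (g x z - η x * η z) + Q y * g x (φ z) +
        (P z * (g x y - η x * η y) + Q z * g x (φ y)) +
        2 * W ^ 2 * η x * (dw (φ y) * η z + dw (φ z) * η y) = 0 := fun x y z ↦ by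
      rw [← key, H, sub_self]; simp
    -- At `x = y = ξ` every horizontal term vanishes and only `2 W² dw(φ z)` survives.
    have hw : ∀ z, dw (φ z) = 0 := fun z ↦ by
      have := G0 ξ ξ z
      simp [h.xi_metric, h.eta_xi, h.eta_phi, h.phi_xi, hW] at this
      exact this
    -- On the diagonal `y = z`, with `Y` the horizontal part of `y`, the identity says that `P(y) Y
    -- + Q(y) φ Y` is `g`-orthogonal to every `x`.
    have hPQ : ∀ y, y - η y • ξ ≠ 0 → P y = 0 ∧ Q y = 0 := fun y hy ↦ by
      refine h.eq_zero_of_smul_add_smul_phi (h.eta_sub_xi y) hy (h.nondegenerate _ fun x ↦ ?_)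
      have := G0 x y y
      simp only [hw] at this
      rw [h.symm]
      simp [h.phi_xi, h.metric_xi]
      linear_combination this / 2
    have hPQ' : ∀ y, P y = 0 ∧ Q y = 0 := fun y ↦ by
      by_cases hy : y - η y • ξ = 0
      -- For `y` proportional to `ξ` the diagonal gives nothing; additivity of `P` and `Q` recovers
      -- their values from `Y` and `y + Y`. This is where `ker η ≠ 0` enters.
      · obtain ⟨Y, hY0, hY1⟩ := hY
        have h1 := hPQ Y (by simpa [hY0] using hY1)
        have h2 := hPQ (y + Y) (by
          have : y + Y - η (y + Y) • ξ = (y - η y • ξ) + Y := by simp [hY0]; abel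
          rw [this, hy, zero_add]; exact hY1)
        have hPa : P (y + Y) = P y + P Y := by simp [hP]; ring
        have hQa : Q (y + Y) = Q y + Q Y := by simp [hQ]; ring
        exact ⟨by linarith [h1.1, h2.1], by linarith [h1.2, h2.2]⟩
      · exact hPQ y hy
    intro y
    obtain ⟨h1, h2⟩ := hPQ' y
    simp only [hP, hQ] at h1 h2
    -- The coefficients below invert the linear system `P = Q = 0`, whose determinant is `a² + b²`
    -- up to a nonzero factor.
    refine ⟨hw y, ?_, ?_⟩
    · refine (mul_eq_zero.1 (?_ : (a ^ 2 + b ^ 2) * _ = 0)).resolve_left hab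
      linear_combination b / 2 * h1 - a / 2 * h2
    · refine sub_eq_zero.1 ((mul_eq_zero.1 (?_ : (a ^ 2 + b ^ 2) * _ = 0)).resolve_left hab)
      linear_combination a / 2 * h1 + b / 2 * h2
  · intro H x y
    rw [← sub_eq_zero]
    refine hK.nondegenerate _ fun z ↦ ?_
    have hP0 : ∀ y, P y = 0 := fun y ↦ by simp only [hP, (H y).2.1, (H y).2.2]; ring
    have hQ0 : ∀ y, Q y = 0 := fun y ↦ by simp only [hQ, (H y).2.1, (H y).2.2]; ring
    have := key x y z
    simp only [hP0, hQ0, (H y).1, (H z).1] at this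
    linarith

end IsContactModel

end ConformalAlgebra

/-! ### Smoothness of the transformed metric. -/

section Smoothness

variable {E : Type*} [NormedAddCommGroup E] [NormedSpace ℝ E]
  {M : Type*} [TopologicalSpace M] [ChartedSpace E M] [IsManifold 𝓘(ℝ, E) ∞ M]

/-- Near `p₀` the coordinate expression is the composite of those of `φ` and `g`, because the
trivialization inserted between them cancels against its inverse on the base set. -/
theorem contMDiff_precomp_comp {φ : EndField E M} {g : BilinField E M}
    (hφ : ContMDiff 𝓘(ℝ, E) (𝓘(ℝ, E).prod 𝓘(ℝ, E →L[ℝ] E)) ∞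
      (fun p ↦ TotalSpace.mk' (E →L[ℝ] E) p (φ p)))
    (hg : ContMDiff 𝓘(ℝ, E) (𝓘(ℝ, E).prod 𝓘(ℝ, E →L[ℝ] E →L[ℝ] ℝ)) ∞
      (fun p ↦ TotalSpace.mk' (E →L[ℝ] E →L[ℝ] ℝ) p (g p))) :
    ContMDiff 𝓘(ℝ, E) (𝓘(ℝ, E).prod 𝓘(ℝ, E →L[ℝ] E →L[ℝ] ℝ)) ∞
      (fun p ↦ TotalSpace.mk' (E →L[ℝ] E →L[ℝ] ℝ)
        (E := fun p : M ↦ TangentSpace 𝓘(ℝ, E) p →L[ℝ] TangentSpace 𝓘(ℝ, E) p →L[ℝ] ℝ) p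
        ((ContinuousLinearMap.precomp ℝ (φ p)).comp (g p))) := by
  intro p₀
  have h1 := ((contMDiffAt_hom_bundle _).1 (hφ p₀)).2
  have h2 := ((contMDiffAt_hom_bundle _).1 (hg p₀)).2
  refine (contMDiffAt_hom_bundle _).2 ⟨contMDiffAt_id, ?_⟩
  have h3 := h1.clm_precomp (F₃ := ℝ)
  refine (h3.clm_comp h2).congr_of_eventuallyEq ?_
  filter_upwards [(trivializationAt E (TangentSpace 𝓘(ℝ, E)) p₀).open_baseSet.mem_nhds
    (FiberBundle.mem_baseSet_trivializationAt' p₀)] with p hp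
  ext x y
  have hp' : p ∈ (trivializationAt ℝ (Trivial M ℝ) p₀).baseSet := by simp
  simp only [ContinuousLinearMap.comp_apply, ContinuousLinearMap.precomp_apply]
  erw [inCoordinates_apply_eq₂ hp hp hp', inCoordinates_apply_eq₂ hp hp hp']
  refine congrArg _ (congrArg (g p _) ?_)
  rw [ContinuousLinearMap.inCoordinates]
  simp only [ContinuousLinearMap.comp_apply]
  rw [← Trivialization.symmL_apply (R := ℝ) _ hp, ← Trivialization.symmL_apply (R := ℝ) _ hp,
    Trivialization.symmL_continuousLinearMapAt _ hp]
  rfl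

omit [IsManifold 𝓘(ℝ, E) ∞ M] in
theorem contMDiffAt_smulRight {F : Type*} [NormedAddCommGroup F] [NormedSpace ℝ F]
    {f : M → E →L[ℝ] ℝ} {h : M → F} {p : M} (hf : ContMDiffAt 𝓘(ℝ, E) 𝓘(ℝ, E →L[ℝ] ℝ) ∞ f p)
    (hh : ContMDiffAt 𝓘(ℝ, E) 𝓘(ℝ, F) ∞ h p) :
    ContMDiffAt 𝓘(ℝ, E) 𝓘(ℝ, E →L[ℝ] F) ∞ (fun q ↦ (f q).smulRight (h q)) p :=
  (isBoundedBilinearMap_smulRight (𝕜 := ℝ) (E := E) (F := F)).contDiff.contMDiff.contMDiffAt.comp p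
    (hf.prodMk_space hh)

theorem contMDiff_smulRight {η : OneForm E M}
    (hη : ContMDiff 𝓘(ℝ, E) (𝓘(ℝ, E).prod 𝓘(ℝ, E →L[ℝ] ℝ)) ∞
      (fun p ↦ TotalSpace.mk' (E →L[ℝ] ℝ) p (η p))) :
    ContMDiff 𝓘(ℝ, E) (𝓘(ℝ, E).prod 𝓘(ℝ, E →L[ℝ] E →L[ℝ] ℝ)) ∞
      (fun p ↦ TotalSpace.mk' (E →L[ℝ] E →L[ℝ] ℝ)
        (E := fun p : M ↦ TangentSpace 𝓘(ℝ, E) p →L[ℝ] TangentSpace 𝓘(ℝ, E) p →L[ℝ] ℝ) p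
        ((η p).smulRight (η p))) := by
  intro p₀
  have h1 := ((contMDiffAt_hom_bundle _).1 (hη p₀)).2
  refine (contMDiffAt_hom_bundle _).2 ⟨contMDiffAt_id, ?_⟩
  refine (contMDiffAt_smulRight h1 h1).congr_of_eventuallyEq ?_
  filter_upwards [(trivializationAt E (TangentSpace 𝓘(ℝ, E)) p₀).open_baseSet.mem_nhds
    (FiberBundle.mem_baseSet_trivializationAt' p₀)] with p hp
  ext x y
  have hp' : p ∈ (trivializationAt ℝ (Trivial M ℝ) p₀).baseSet := by simp
  erw [inCoordinates_apply_eq₂ hp hp hp']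
  have e : ∀ z : E, ContinuousLinearMap.inCoordinates E (TangentSpace 𝓘(ℝ, E)) ℝ (Trivial M ℝ)
      p₀ p p₀ p (η p) z = η p ((trivializationAt E (TangentSpace 𝓘(ℝ, E)) p₀).symm p z) := by
    intro z
    simp [ContinuousLinearMap.inCoordinates, Trivialization.symmL_apply (R := ℝ) _ hp]
  refine Eq.trans ?_ (congrArg₂ (· * ·) (e x) (e y)).symm
  simp

theorem contMDiff_confMetric {φ : EndField E M} {η : OneForm E M} {g : BilinField E M}
    (hφ : ContMDiff 𝓘(ℝ, E) (𝓘(ℝ, E).prod 𝓘(ℝ, E →L[ℝ] E)) ∞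
      (fun p ↦ TotalSpace.mk' (E →L[ℝ] E) p (φ p)))
    (hη : ContMDiff 𝓘(ℝ, E) (𝓘(ℝ, E).prod 𝓘(ℝ, E →L[ℝ] ℝ)) ∞
      (fun p ↦ TotalSpace.mk' (E →L[ℝ] ℝ) p (η p)))
    (hg : ContMDiff 𝓘(ℝ, E) (𝓘(ℝ, E).prod 𝓘(ℝ, E →L[ℝ] E →L[ℝ] ℝ)) ∞
      (fun p ↦ TotalSpace.mk' (E →L[ℝ] E →L[ℝ] ℝ) p (g p)))
    {u v w : M → ℝ} (hu : ContMDiff 𝓘(ℝ, E) 𝓘(ℝ, ℝ) ∞ u) (hv : ContMDiff 𝓘(ℝ, E) 𝓘(ℝ, ℝ) ∞ v)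
    (hw : ContMDiff 𝓘(ℝ, E) 𝓘(ℝ, ℝ) ∞ w) :
    ContMDiff 𝓘(ℝ, E) (𝓘(ℝ, E).prod 𝓘(ℝ, E →L[ℝ] E →L[ℝ] ℝ)) ∞
      (fun p ↦ TotalSpace.mk' (E →L[ℝ] E →L[ℝ] ℝ) p (confMetric φ η g u v w p)) := by
  have ha : ContMDiff 𝓘(ℝ, E) 𝓘(ℝ, ℝ) ∞ (fun p ↦ Real.exp (2 * u p) * Real.cos (2 * v p)) :=
    (Real.contDiff_exp.comp_contMDiff (contMDiff_const.mul hu)).mul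
      (Real.contDiff_cos.comp_contMDiff (contMDiff_const.mul hv))
  have hb : ContMDiff 𝓘(ℝ, E) 𝓘(ℝ, ℝ) ∞ (fun p ↦ Real.exp (2 * u p) * Real.sin (2 * v p)) :=
    (Real.contDiff_exp.comp_contMDiff (contMDiff_const.mul hu)).mul
      (Real.contDiff_sin.comp_contMDiff (contMDiff_const.mul hv))
  have hc : ContMDiff 𝓘(ℝ, E) 𝓘(ℝ, ℝ) ∞
      (fun p ↦ Real.exp (2 * w p) - Real.exp (2 * u p) * Real.cos (2 * v p)) :=
    (Real.contDiff_exp.comp_contMDiff (contMDiff_const.mul hw)).sub ha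
  exact ((ha.smul_section hg).add_section
    (hb.smul_section (contMDiff_precomp_comp hφ hg))).add_section (hc.smul_section (contMDiff_smulRight hη))

end Smoothness

/-! ### Levi-Civita connections and the transformed structure. -/

section Geometry

variable {E : Type*} [NormedAddCommGroup E] [NormedSpace ℝ E]
  {M : Type*} [TopologicalSpace M] [ChartedSpace E M]

section

variable [IsManifold 𝓘(ℝ, E) ∞ M] {φ : EndField E M} {ξ : VecField E M} {η : OneForm E M}
  {g : BilinField E M}

theorem IsAlmostContactComplexRiemannian.model
    (h : IsAlmostContactComplexRiemannian φ ξ η g) (p : M) :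
    IsContactModel (φ p) (ξ p) (η p) (g p) where
  phi_xi := h.phi_xi p
  phi_phi := h.phi_phi p
  eta_phi := h.eta_phi p
  eta_xi := h.eta_xi p
  symm := h.metric_symm p
  nondegenerate := h.metric_nondegenerate p
  compat := h.metric_compat p

/-- The transformed structure satisfies the algebraic identities at each point. -/
theorem IsAlmostContactComplexRiemannian.model_conf
    (h : IsAlmostContactComplexRiemannian φ ξ η g) (u v w : M → ℝ) (p : M) :
    IsContactModel (φ p) (confXi ξ w p) (confEta η w p) (confMetric φ η g u v w p) := by
  have := (h.model p).conformal (a := Real.exp (2 * u p) * Real.cos (2 * v p))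
    (b := Real.exp (2 * u p) * Real.sin (2 * v p)) (W := Real.exp (w p))
    (k := confMetric φ η g u v w p) ?_ (Real.exp_ne_zero _) ?_
  · rwa [← Real.exp_neg] at this
  · have : Real.exp (2 * u p) ^ 2 * (Real.sin (2 * v p) ^ 2 + Real.cos (2 * v p) ^ 2) ≠ 0 := by
      rw [Real.sin_sq_add_cos_sq]; positivity
    convert this using 1; ring
  · intro x y
    rw [confMetric_apply, ← Real.exp_nat_mul]
    norm_num

theorem IsAlmostContactComplexRiemannian.conf
    (h : IsAlmostContactComplexRiemannian φ ξ η g) {u v w : M → ℝ}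
    (hu : ContMDiff 𝓘(ℝ, E) 𝓘(ℝ, ℝ) ∞ u) (hv : ContMDiff 𝓘(ℝ, E) 𝓘(ℝ, ℝ) ∞ v)
    (hw : ContMDiff 𝓘(ℝ, E) 𝓘(ℝ, ℝ) ∞ w) :
    IsAlmostContactComplexRiemannian φ (confXi ξ w) (confEta η w) (confMetric φ η g u v w) where
  smooth_phi := h.smooth_phi
  smooth_xi := (Real.contDiff_exp.comp_contMDiff hw.neg).smul_section h.smooth_xi
  smooth_eta := (Real.contDiff_exp.comp_contMDiff hw).smul_section h.smooth_eta
  smooth_metric := contMDiff_confMetric h.smooth_phi h.smooth_eta h.smooth_metric hu hv hw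
  phi_xi p := (h.model_conf u v w p).phi_xi
  phi_phi p := (h.model_conf u v w p).phi_phi
  eta_phi p := (h.model_conf u v w p).eta_phi
  eta_xi p := (h.model_conf u v w p).eta_xi
  metric_symm p := (h.model_conf u v w p).symm
  metric_nondegenerate p := (h.model_conf u v w p).nondegenerate
  metric_compat p := (h.model_conf u v w p).compat

end

variable [FiniteDimensional ℝ E] [CompleteSpace E] [IsManifold 𝓘(ℝ, E) ∞ M]
  {φ : EndField E M} {ξ : VecField E M} {η : OneForm E M} {g : BilinField E M}
  {cov : CovariantDerivative 𝓘(ℝ, E) E (TangentSpace 𝓘(ℝ, E) : M → Type _)}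

/-- A vector field is differentiable at `p`. -/
abbrev VecField.DiffAt (Y : VecField E M) (p : M) : Prop :=
  MDifferentiableAt 𝓘(ℝ, E) (𝓘(ℝ, E).prod 𝓘(ℝ, E)) (fun q ↦ TotalSpace.mk' E q (Y q)) p

omit [FiniteDimensional ℝ E] [CompleteSpace E] in
theorem exists_vecField_extending (p : M) (y : TangentSpace 𝓘(ℝ, E) p) :
    ∃ Y : VecField E M, VecField.DiffAt Y p ∧ Y p = y :=
  ⟨FiberBundle.extend (E := (TangentSpace 𝓘(ℝ, E) : M → Type _)) E y,
    FiberBundle.mdifferentiableAt_extend .., by simp⟩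

namespace IsAlmostContactComplexRiemannian

omit [FiniteDimensional ℝ E] [CompleteSpace E] in
theorem diffAt_phi (h : IsAlmostContactComplexRiemannian φ ξ η g) {Y : VecField E M} {p : M}
    (hY : VecField.DiffAt Y p) : VecField.DiffAt (fun q ↦ φ q (Y q)) p :=
  MDifferentiableAt.clm_bundle_apply (F₁ := E) (F₂ := E)
    ((h.smooth_phi p).mdifferentiableAt (by simp)) hY

omit [FiniteDimensional ℝ E] [CompleteSpace E] in
theorem diffAt_xi (h : IsAlmostContactComplexRiemannian φ ξ η g) (p : M) :
    VecField.DiffAt ξ p := (h.smooth_xi p).mdifferentiableAt (by simp)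

omit [FiniteDimensional ℝ E] [CompleteSpace E] in
theorem mdifferentiableAt_metric (h : IsAlmostContactComplexRiemannian φ ξ η g)
    {Y Z : VecField E M} {p : M} (hY : VecField.DiffAt Y p) (hZ : VecField.DiffAt Z p) :
    MDifferentiableAt 𝓘(ℝ, E) 𝓘(ℝ, ℝ) (fun q ↦ g q (Y q) (Z q)) p := by
  have := MDifferentiableAt.clm_bundle_apply₂ (F₁ := E) (F₂ := E) (F₃ := ℝ)
    (E₃ := fun _ : M ↦ ℝ) ((h.smooth_metric p).mdifferentiableAt (by simp)) hY hZ
  exact ((mdifferentiableAt_totalSpace 𝓘(ℝ, E) _).1 this).2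

variable (h : IsAlmostContactComplexRiemannian φ ξ η g) (hc : IsLeviCivita g cov)
include h hc

/-- Differentiate `g(φ Y, Z) = g(Y, φ Z)`: the covariant derivative of a self-adjoint field is
self-adjoint. -/
theorem nablaEnd_symm (p : M) (x y z : TangentSpace 𝓘(ℝ, E) p) :
    g p (nablaEnd cov φ p x y) z = g p (nablaEnd cov φ p x z) y := by
  obtain ⟨Y, hY, rfl⟩ := exists_vecField_extending p y
  obtain ⟨Z, hZ, rfl⟩ := exists_vecField_extending p z
  rw [nablaEnd_eq cov φ h.smooth_phi p x Y hY, nablaEnd_eq cov φ h.smooth_phi p x Z hZ]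
  have e1 := hc.metric p (fun q ↦ φ q (Y q)) Z (h.diffAt_phi hY) hZ x
  have e2 := hc.metric p Y (fun q ↦ φ q (Z q)) hY (h.diffAt_phi hZ) x
  have e3 : (fun q ↦ g q (φ q (Y q)) (Z q)) = (fun q ↦ g q (Y q) (φ q (Z q))) :=
    funext fun q ↦ (h.model q).metric_phi_left _ _
  rw [e3] at e1
  have m := h.model p
  simp only [map_sub, _root_.sub_apply, m.metric_phi_left] at e1 e2 ⊢
  rw [m.symm (cov (fun q ↦ φ q (Z q)) p x), m.symm (cov Z p x) (φ p (Y p)), m.metric_phi_left]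
  linarith [e1.symm.trans e2]

-- Since `φ ξ = 0`, `(∇_x φ) ξ = -φ(∇_x ξ)`, which is horizontal and hence orthogonal to `ξ`.
omit [CompleteSpace E] hc in
theorem nablaEnd_xi_xi (p : M) (x : TangentSpace 𝓘(ℝ, E) p) :
    g p (nablaEnd cov φ p x (ξ p)) (ξ p) = 0 := by
  rw [nablaEnd_eq cov φ h.smooth_phi p x ξ (h.diffAt_xi p)]
  have e : (fun q ↦ φ q (ξ q)) = (0 : VecField E M) := funext h.phi_xi
  rw [e, cov.zero]
  have m := h.model p
  simp [m.metric_xi, m.eta_phi]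

/-- With its Levi-Civita connection, a structure is Sasaki-like if and only if
`(∇_x φ) y = -g(x, y) ξ - η(y) x + 2 η(x) η(y) ξ`. -/
theorem sasakiLike_conditions_iff :
    (∀ (p : M) (X Y Z : TangentSpace 𝓘(ℝ, E) p), η p X = 0 → η p Y = 0 → η p Z = 0 →
        structureTensor cov φ g p X Y Z = 0 ∧
        structureTensor cov φ g p (ξ p) Y Z = 0 ∧
        structureTensor cov φ g p (ξ p) (ξ p) Z = 0 ∧
        structureTensor cov φ g p X Y (ξ p) = -g p X Y) ↔
    ∀ (p : M) (x y : TangentSpace 𝓘(ℝ, E) p),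
      nablaEnd cov φ p x y = sasakiTensor (ξ p) (η p) (g p) x y :=
  forall_congr' fun p ↦ (h.model p).sasaki_conditions_iff (nablaEnd cov φ p)
    (fun x x' y ↦ by simp only [nablaEnd, map_add]; abel)
    (fun c x y ↦ by simp only [nablaEnd, map_smul, smul_sub])
    (h.nablaEnd_symm hc p) (h.nablaEnd_xi_xi p)

variable (hn : ∀ (p : M) (x y : TangentSpace 𝓘(ℝ, E) p),
      nablaEnd cov φ p x y = sasakiTensor (ξ p) (η p) (g p) x y)
include hn

/-- The structure equation at `y = ξ` reads `-φ(∇_x ξ) = φ² x`. As `g(ξ, ξ) = 1`, the vector `∇_x ξ`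
is horizontal, so one more application of `φ` recovers it. -/
theorem cov_xi (p : M) (x : TangentSpace 𝓘(ℝ, E) p) : cov ξ p x = -φ p x := by
  have m := h.model p
  have h1 := hn p x (ξ p)
  rw [nablaEnd_eq cov φ h.smooth_phi p x ξ (h.diffAt_xi p)] at h1
  have e : (fun q ↦ φ q (ξ q)) = (0 : VecField E M) := funext h.phi_xi
  rw [e, cov.zero] at h1
  have h2 := hc.metric p ξ ξ (h.diffAt_xi p) (h.diffAt_xi p) x
  have e' : (fun q ↦ g q (ξ q) (ξ q)) = fun _ ↦ (1 : ℝ) :=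
    funext fun q ↦ by rw [(h.model q).metric_xi, h.eta_xi]
  rw [e', mvfderiv_const, m.metric_xi, m.xi_metric] at h2
  have h3 : η p (cov ξ p x) = 0 := by simp at h2; linarith
  have h4 := congrArg (φ p) h1
  simp [sasakiTensor, m.phi_phi, m.phi_xi, h3, m.eta_xi] at h4
  exact h4

/-- The derivative of `k = a g + b g(·, φ ·) + c η ⊗ η` along a Sasaki-like manifold. -/
theorem mvfderiv_conformal {k : BilinField E M} {a b c : M → ℝ}
    (hk : ∀ q (y z : TangentSpace 𝓘(ℝ, E) q),
      k q y z = a q * g q y z + b q * g q y (φ q z) + c q * (η q y * η q z))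
    {p : M} (ha : MDifferentiableAt 𝓘(ℝ, E) 𝓘(ℝ, ℝ) a p)
    (hb : MDifferentiableAt 𝓘(ℝ, E) 𝓘(ℝ, ℝ) b p) (hc' : MDifferentiableAt 𝓘(ℝ, E) 𝓘(ℝ, ℝ) c p)
    {Y Z : VecField E M} (hY : VecField.DiffAt Y p) (hZ : VecField.DiffAt Z p)
    (x : TangentSpace 𝓘(ℝ, E) p) :
    mvfderiv 𝓘(ℝ, E) (fun q ↦ k q (Y q) (Z q)) p x =
      confDeriv (φ p) (ξ p) (η p) (g p) (b p) (c p) (mvfderiv 𝓘(ℝ, E) a p)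
        (mvfderiv 𝓘(ℝ, E) b p) (mvfderiv 𝓘(ℝ, E) c p) x (Y p) (Z p) +
      k p (cov Y p x) (Z p) + k p (Y p) (cov Z p x) := by
  have m := h.model p
  have hξ := h.diffAt_xi p
  -- Writing `η` as `g(·, ξ)` reduces everything to metric compatibility of `cov`, the formula for
  -- `∇φ` and `∇ξ = -φ`.
  have e : (fun q ↦ k q (Y q) (Z q)) = a * (fun q ↦ g q (Y q) (Z q)) +
      b * (fun q ↦ g q (Y q) (φ q (Z q))) +
      c * ((fun q ↦ g q (Y q) (ξ q)) * fun q ↦ g q (Z q) (ξ q)) :=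
    funext fun q ↦ by
      simp only [Pi.add_apply, Pi.mul_apply]
      rw [hk, (h.model q).metric_xi, (h.model q).metric_xi]
  have d1 := h.mdifferentiableAt_metric hY hZ
  have d2 := h.mdifferentiableAt_metric hY (h.diffAt_phi hZ)
  have d3 := h.mdifferentiableAt_metric hY hξ
  have d4 := h.mdifferentiableAt_metric hZ hξ
  have e1 := hc.metric p Y Z hY hZ x
  have e2 := hc.metric p Y (fun q ↦ φ q (Z q)) hY (h.diffAt_phi hZ) x
  have e3 := hc.metric p Y ξ hY hξ x
  have e4 := hc.metric p Z ξ hZ hξ x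
  have e5 := hn p x (Z p)
  rw [nablaEnd_eq cov φ h.smooth_phi p x Z hZ, sub_eq_iff_eq_add] at e5
  rw [e, mvfderiv_add ((ha.mul d1).add (hb.mul d2)) (hc'.mul (d3.mul d4)),
    mvfderiv_add (ha.mul d1) (hb.mul d2), mvfderiv_mul ha d1, mvfderiv_mul hb d2,
    mvfderiv_mul hc' (d3.mul d4), mvfderiv_mul d3 d4]
  simp only [Pi.mul_apply, _root_.add_apply, _root_.smul_apply, smul_eq_mul, e1, e2, e3, e4, e5,
    map_add, hk, h.cov_xi hc hn, m.metric_xi, confDeriv, map_neg, m.metric_phi_left]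
  rw [m.metric_phi_symm x (Y p), m.metric_phi_symm x (Z p)]
  ring

end IsAlmostContactComplexRiemannian

omit [FiniteDimensional ℝ E] [CompleteSpace E] [IsManifold 𝓘(ℝ, E) ∞ M] in
theorem mvfderiv_comp_hasDerivAt {F : ℝ → ℝ} {F' : ℝ} {f : M → ℝ} {p : M}
    (hF : HasDerivAt F F' (f p)) (hf : MDifferentiableAt 𝓘(ℝ, E) 𝓘(ℝ, ℝ) f p)
    (x : TangentSpace 𝓘(ℝ, E) p) :
    mvfderiv 𝓘(ℝ, E) (fun q ↦ F (f q)) p x = F' * mvfderiv 𝓘(ℝ, E) f p x := by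
  have := (hF.hasFDerivAt.hasMFDerivAt.comp p hf.hasMFDerivAt).mfderiv
  simp only [mvfderiv]
  change mfderiv 𝓘(ℝ, E) 𝓘(ℝ, ℝ) (F ∘ f) p x = _
  rw [this]
  exact mul_comm (mvfderiv 𝓘(ℝ, E) f p x) F'

/-- A connection that differs from a torsion free connection `cov` by the tensor `D` is
Levi-Civita for `k` if and only if `D` is symmetric and cancels `∇ k`. -/
theorem isLeviCivita_iff_of_difference {k : BilinField E M} (hc : cov.torsion = 0)
    {cov' : CovariantDerivative 𝓘(ℝ, E) E (TangentSpace 𝓘(ℝ, E) : M → Type _)}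
    {D : Π p : M, TangentSpace 𝓘(ℝ, E) p →L[ℝ] TangentSpace 𝓘(ℝ, E) p →L[ℝ]
      TangentSpace 𝓘(ℝ, E) p}
    (hD : ∀ (p : M) (Y : VecField E M), VecField.DiffAt Y p →
      ∀ x, cov' Y p x = cov Y p x + D p (Y p) x)
    {T : Π p : M, TangentSpace 𝓘(ℝ, E) p → TangentSpace 𝓘(ℝ, E) p → TangentSpace 𝓘(ℝ, E) p → ℝ}
    (hT : ∀ (p : M) (Y Z : VecField E M), VecField.DiffAt Y p → VecField.DiffAt Z p → ∀ x,
      mvfderiv 𝓘(ℝ, E) (fun q ↦ k q (Y q) (Z q)) p x =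
        T p x (Y p) (Z p) + k p (cov Y p x) (Z p) + k p (Y p) (cov Z p x)) :
    IsLeviCivita k cov' ↔ ∀ p, (∀ x y, D p x y = D p y x) ∧
      ∀ x y z, k p (D p y x) z + k p y (D p z x) = T p x y z := by
  rw [CovariantDerivative.torsion_eq_zero_iff] at hc
  constructor
  · intro h
    refine fun p ↦ ⟨fun x y ↦ ?_, fun x y z ↦ ?_⟩
    · obtain ⟨X, hX, rfl⟩ := exists_vecField_extending p x
      obtain ⟨Y, hY, rfl⟩ := exists_vecField_extending p y
      have h1 := ((CovariantDerivative.torsion_eq_zero_iff cov').1 h.torsion_eq_zero hX hY).trans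
        (hc hX hY).symm
      rw [hD p X hX, hD p Y hY] at h1
      have h2 : D p (Y p) (X p) - D p (X p) (Y p) = 0 := by
        rw [← sub_eq_zero] at h1
        rw [← h1]; abel
      exact (sub_eq_zero.1 h2).symm
    · obtain ⟨Y, hY, rfl⟩ := exists_vecField_extending p y
      obtain ⟨Z, hZ, rfl⟩ := exists_vecField_extending p z
      have h1 := h.metric p Y Z hY hZ x
      rw [hT p Y Z hY hZ, hD p Y hY, hD p Z hZ] at h1
      simp only [map_add, _root_.add_apply] at h1
      linarith
  · intro h
    refine ⟨(CovariantDerivative.torsion_eq_zero_iff cov').2 fun {X Y p} hX hY ↦ ?_,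
      fun p Y Z hY hZ x ↦ ?_⟩
    · rw [← hc hX hY, hD p X hX, hD p Y hY, (h p).1 (Y p) (X p)]
      abel
    · rw [hT p Y Z hY hZ, hD p Y hY, hD p Z hZ, ← (h p).2]
      simp only [map_add, _root_.add_apply]
      ring

omit [CompleteSpace E] in
theorem nablaEnd_of_difference
    {cov' : CovariantDerivative 𝓘(ℝ, E) E (TangentSpace 𝓘(ℝ, E) : M → Type _)}
    {D : Π p : M, TangentSpace 𝓘(ℝ, E) p →L[ℝ] TangentSpace 𝓘(ℝ, E) p →L[ℝ]
      TangentSpace 𝓘(ℝ, E) p}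
    (hD : ∀ (p : M) (Y : VecField E M), VecField.DiffAt Y p →
      ∀ x, cov' Y p x = cov Y p x + D p (Y p) x)
    (h : IsAlmostContactComplexRiemannian φ ξ η g) (p : M) (x y : TangentSpace 𝓘(ℝ, E) p) :
    nablaEnd cov' φ p x y = nablaEnd cov φ p x y + D p (φ p y) x - φ p (D p y x) := by
  obtain ⟨Y, hY, rfl⟩ := exists_vecField_extending p y
  rw [nablaEnd_eq cov φ h.smooth_phi p x Y hY, nablaEnd_eq cov' φ h.smooth_phi p x Y hY,
    hD p Y hY, hD p _ (h.diffAt_phi hY), map_add]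
  abel

/-- A contact conformal transformation of a Sasaki-like structure is Sasaki-like if and only if
the three equations on the differentials of `u`, `v`, `w` hold. -/
theorem isSasakiLike_conf_iff (hS : IsSasakiLike φ ξ η g)
    (hdim : ∀ p, ∃ Y : TangentSpace 𝓘(ℝ, E) p, η p Y = 0 ∧ Y ≠ 0) {u v w : M → ℝ}
    (hu : ContMDiff 𝓘(ℝ, E) 𝓘(ℝ, ℝ) ∞ u) (hv : ContMDiff 𝓘(ℝ, E) 𝓘(ℝ, ℝ) ∞ v)
    (hw : ContMDiff 𝓘(ℝ, E) 𝓘(ℝ, ℝ) ∞ w) :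
    IsSasakiLike φ (confXi ξ w) (confEta η w) (confMetric φ η g u v w) ↔
      ∀ (p : M) (x : TangentSpace 𝓘(ℝ, E) p),
        mvfderiv 𝓘(ℝ, E) w p (φ p x) = 0 ∧
        mvfderiv 𝓘(ℝ, E) u p x - mvfderiv 𝓘(ℝ, E) v p (φ p x) = 0 ∧
        mvfderiv 𝓘(ℝ, E) u p (φ p x) + mvfderiv 𝓘(ℝ, E) v p x = (1 - Real.exp (w p)) * η p x := by
  obtain ⟨h, cov, hc, hF⟩ := hS
  have hn := (h.sasakiLike_conditions_iff hc).1 hF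
  have h' := h.conf hu hv hw
  set k := confMetric φ η g u v w
  set a : M → ℝ := fun p ↦ Real.exp (2 * u p) * Real.cos (2 * v p) with ha
  set b : M → ℝ := fun p ↦ Real.exp (2 * u p) * Real.sin (2 * v p) with hb
  set c : M → ℝ := fun p ↦ Real.exp (2 * w p) - a p with hc'
  have du : MDifferentiable 𝓘(ℝ, E) 𝓘(ℝ, ℝ) u := hu.mdifferentiable (by simp)
  have dv : MDifferentiable 𝓘(ℝ, E) 𝓘(ℝ, ℝ) v := hv.mdifferentiable (by simp)
  have dw : MDifferentiable 𝓘(ℝ, E) 𝓘(ℝ, ℝ) w := hw.mdifferentiable (by simp)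
  have fexp : ∀ t : ℝ, HasDerivAt (fun s ↦ Real.exp (2 * s)) (2 * Real.exp (2 * t)) t := fun t ↦ by
    simpa [mul_comm] using ((hasDerivAt_id t).const_mul 2).exp
  have fcos : ∀ t : ℝ, HasDerivAt (fun s ↦ Real.cos (2 * s)) (-2 * Real.sin (2 * t)) t := fun t ↦ by
    simpa [mul_comm] using ((hasDerivAt_id t).const_mul 2).cos
  have fsin : ∀ t : ℝ, HasDerivAt (fun s ↦ Real.sin (2 * s)) (2 * Real.cos (2 * t)) t := fun t ↦ by
    simpa [mul_comm] using ((hasDerivAt_id t).const_mul 2).sin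
  have d1 : ∀ {f : M → ℝ}, MDifferentiable 𝓘(ℝ, E) 𝓘(ℝ, ℝ) f → ∀ p,
      MDifferentiableAt 𝓘(ℝ, E) 𝓘(ℝ, ℝ) (fun q ↦ Real.exp (2 * f q)) p := fun hf p ↦
    (fexp _).differentiableAt.comp_mdifferentiableAt (hf p)
  have d2 : ∀ p, MDifferentiableAt 𝓘(ℝ, E) 𝓘(ℝ, ℝ) (fun q ↦ Real.cos (2 * v q)) p := fun p ↦
    (fcos _).differentiableAt.comp_mdifferentiableAt (dv p)
  have d3 : ∀ p, MDifferentiableAt 𝓘(ℝ, E) 𝓘(ℝ, ℝ) (fun q ↦ Real.sin (2 * v q)) p := fun p ↦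
    (fsin _).differentiableAt.comp_mdifferentiableAt (dv p)
  have da : ∀ p, MDifferentiableAt 𝓘(ℝ, E) 𝓘(ℝ, ℝ) a p := fun p ↦ (d1 du p).mul (d2 p)
  have db : ∀ p, MDifferentiableAt 𝓘(ℝ, E) 𝓘(ℝ, ℝ) b p := fun p ↦ (d1 du p).mul (d3 p)
  have dc : ∀ p, MDifferentiableAt 𝓘(ℝ, E) 𝓘(ℝ, ℝ) c p := fun p ↦ (d1 dw p).sub (da p)
  -- `hda` and `hdb` are the two parts of `d(a + ib) = 2 (a + ib)(du + i dv)`.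
  have hda : ∀ p x, mvfderiv 𝓘(ℝ, E) a p x =
      2 * a p * mvfderiv 𝓘(ℝ, E) u p x - 2 * b p * mvfderiv 𝓘(ℝ, E) v p x := fun p x ↦ by
    rw [ha, mvfderiv_fun_mul (d1 du p) (d2 p)]
    simp only [_root_.add_apply, _root_.smul_apply, smul_eq_mul,
      mvfderiv_comp_hasDerivAt (fexp _) (du p), mvfderiv_comp_hasDerivAt (fcos _) (dv p), hb]
    ring
  have hdb : ∀ p x, mvfderiv 𝓘(ℝ, E) b p x =
      2 * b p * mvfderiv 𝓘(ℝ, E) u p x + 2 * a p * mvfderiv 𝓘(ℝ, E) v p x := fun p x ↦ by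
    rw [hb, mvfderiv_fun_mul (d1 du p) (d3 p)]
    simp only [_root_.add_apply, _root_.smul_apply, smul_eq_mul,
      mvfderiv_comp_hasDerivAt (fexp _) (du p), mvfderiv_comp_hasDerivAt (fsin _) (dv p), ha]
    ring
  have hW : ∀ p, Real.exp (2 * w p) = Real.exp (w p) ^ 2 := fun p ↦ by
    rw [← Real.exp_nat_mul]; norm_num
  have hcW : ∀ p, c p = Real.exp (w p) ^ 2 - a p := fun p ↦ by rw [← hW]
  have hdc : ∀ p x, mvfderiv 𝓘(ℝ, E) c p x =
      2 * Real.exp (w p) ^ 2 * mvfderiv 𝓘(ℝ, E) w p x - mvfderiv 𝓘(ℝ, E) a p x := fun p x ↦ by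
    rw [hc', mvfderiv_fun_sub (d1 dw p) (da p), _root_.sub_apply,
      mvfderiv_comp_hasDerivAt (fexp _) (dw p), hW]
  have hkapp : ∀ p (x y : TangentSpace 𝓘(ℝ, E) p),
      k p x y = a p * g p x y + b p * g p x (φ p y) + c p * (η p x * η p y) :=
    confMetric_apply φ η g u v w
  have hab : ∀ p, a p ^ 2 + b p ^ 2 ≠ 0 := fun p ↦ by
    have : Real.exp (2 * u p) ^ 2 * (Real.sin (2 * v p) ^ 2 + Real.cos (2 * v p) ^ 2) ≠ 0 := by
      rw [Real.sin_sq_add_cos_sq]; positivity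
    convert this using 1
    simp only [ha, hb]; ring
  have hT := fun p Y Z hY hZ x ↦
    h.mvfderiv_conformal hc hn hkapp (da p) (db p) (dc p) (Y := Y) (Z := Z) hY hZ x
  have hpt := fun p (D : TangentSpace 𝓘(ℝ, E) p →L[ℝ] TangentSpace 𝓘(ℝ, E) p →L[ℝ]
      TangentSpace 𝓘(ℝ, E) p) ↦
    (h.model p).sasakiTensor_conformal_iff (hdim p) (hab p) (Real.exp_ne_zero (w p))
      (k := k p) (fun x y ↦ by rw [hkapp, hcW]) (hda p) (hdb p) (hdc p) (D := D)
  simp only [← hcW, ← Real.exp_neg] at hpt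
  constructor
  · rintro ⟨-, cov', hc'', hF'⟩ p
    have hn' := (h'.sasakiLike_conditions_iff hc'').1 hF'
    -- Here the connection is given and `D` is its difference from `cov`; no uniqueness theorem is
    -- needed, since the pointwise criterion holds for every admissible `D`.
    have hD : ∀ (p : M) (Y : VecField E M), VecField.DiffAt Y p →
        ∀ x, cov' Y p x = cov Y p x + cov'.difference cov p (Y p) x := fun p Y hY x ↦ by
      rw [CovariantDerivative.difference, IsCovariantDerivativeOn.difference_apply _ _ (hσ := hY)]
      simp
    have hLC := (isLeviCivita_iff_of_difference hc.torsion_eq_zero hD hT).1 hc''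
    refine (hpt p _ (hLC p).1 (hLC p).2).1 fun x y ↦ ?_
    rw [← hn, ← nablaEnd_of_difference hD h, hn']
    rfl
  · intro H
    have (p : M) : FiniteDimensional ℝ (TangentSpace 𝓘(ℝ, E) p) :=
      inferInstanceAs (FiniteDimensional ℝ E)
    have (p : M) : T2Space (TangentSpace 𝓘(ℝ, E) p) := inferInstanceAs (T2Space E)
    -- Conversely, the new Levi-Civita connection is built by solving for `D` at each point
    -- separately and adding it to `cov`.
    choose D hDs hDk using fun p ↦ (h.model p).exists_difference (h'.metric_nondegenerate p)
      (h'.metric_symm p) (b p) (c p) (mvfderiv 𝓘(ℝ, E) a p) (mvfderiv 𝓘(ℝ, E) b p)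
      (mvfderiv 𝓘(ℝ, E) c p)
    have hD : ∀ (p : M) (Y : VecField E M), VecField.DiffAt Y p →
        ∀ x, cov.addOneForm D Y p x = cov Y p x + D p (Y p) x := fun p Y _ x ↦ rfl
    have hc'' := (isLeviCivita_iff_of_difference hc.torsion_eq_zero hD hT).2
      fun p ↦ ⟨hDs p, hDk p⟩
    refine ⟨h', cov.addOneForm D, hc'', (h'.sasakiLike_conditions_iff hc'').2 fun p x y ↦ ?_⟩
    rw [nablaEnd_of_difference hD h, hn]
    exact (hpt p (D p) (hDs p) (hDk p)).2 (H p) x y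

end Geometry

/-! ### Integral curves and holomorphy on the leaves. -/

section Consequences

variable {E : Type*} [NormedAddCommGroup E] [NormedSpace ℝ E]
  {M : Type*} [TopologicalSpace M] [ChartedSpace E M]

/-- A function with vanishing derivative along `ξ` is constant along the integral curves of `ξ`. -/
theorem eq_of_isMIntegralCurveOn {ξ : VecField E M} {f : M → ℝ}
    (hf : MDifferentiable 𝓘(ℝ, E) 𝓘(ℝ, ℝ) f) (hξ : ∀ p, mvfderiv 𝓘(ℝ, E) f p (ξ p) = 0)
    {γ : ℝ → M} {s : Set ℝ} (hs : IsPreconnected s) (hγ : IsMIntegralCurveOn γ ξ s)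
    {t t' : ℝ} (ht : t ∈ s) (ht' : t' ∈ s) : f (γ t) = f (γ t') := by
  have hd : ∀ r ∈ s, HasDerivWithinAt (f ∘ γ) 0 s r := by
    intro r hr
    let L : ℝ →L[ℝ] ℝ := (mfderiv 𝓘(ℝ, E) 𝓘(ℝ, ℝ) f (γ r)).comp
      ((1 : ℝ →L[ℝ] ℝ).smulRight (ξ (γ r)))
    have h1 : HasFDerivWithinAt (f ∘ γ) L s r :=
      ((hf (γ r)).hasMFDerivAt.comp_hasMFDerivWithinAt r (hγ r hr)).hasFDerivWithinAt
    refine h1.hasDerivWithinAt.congr_deriv ?_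
    have h3 : mfderiv 𝓘(ℝ, E) 𝓘(ℝ, ℝ) f (γ r) (ξ (γ r)) = 0 := hξ (γ r)
    change mfderiv 𝓘(ℝ, E) 𝓘(ℝ, ℝ) f (γ r) ((1 : ℝ) • ξ (γ r)) = 0
    rw [one_smul, h3]
  -- The mean value inequality with bound `0`; derivatives within `s` cover endpoints of the
  -- interval.
  have := hs.ordConnected.convex.norm_image_sub_le_of_norm_hasDerivWithin_le (C := 0) hd
    (fun _ _ ↦ by simp) ht ht'
  simp only [zero_mul, norm_le_zero_iff, sub_eq_zero] at this
  exact this.symm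

/-- A complex function on a complex manifold whose real and imaginary parts are differentiable and
satisfy the Cauchy-Riemann equations at a point is complex differentiable there. -/
theorem mdifferentiableAt_complex_of_cauchyRiemann {G : Type*} [NormedAddCommGroup G]
    [NormedSpace ℂ G] {N : Type*} [TopologicalSpace N] [ChartedSpace G N] {a b : N → ℝ} {y : N}
    {A B : G →L[ℝ] ℝ} (ha : HasMFDerivAt 𝓘(ℝ, G) 𝓘(ℝ, ℝ) a y A)
    (hb : HasMFDerivAt 𝓘(ℝ, G) 𝓘(ℝ, ℝ) b y B)
    (hA : ∀ X, A (Complex.I • X) = -B X) (hB : ∀ X, B (Complex.I • X) = A X) :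
    MDifferentiableAt 𝓘(ℂ, G) 𝓘(ℂ, ℂ) (fun z ↦ (a z : ℂ) + Complex.I * (b z : ℂ)) y := by
  have key : ∀ {f : N → ℝ} {F : G →L[ℝ] ℝ}, HasMFDerivAt 𝓘(ℝ, G) 𝓘(ℝ, ℝ) f y F →
      HasFDerivAt (writtenInExtChartAt 𝓘(ℝ, G) 𝓘(ℝ, ℝ) y f) F (extChartAt 𝓘(ℝ, G) y y) := by
    intro f F hf
    have h1 := hf.2
    rw [show Set.range 𝓘(ℝ, G) = Set.univ by simp] at h1
    exact hasFDerivWithinAt_univ.1 h1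
  have ha' := key ha
  have hb' := key hb
  refine (mdifferentiableAt_iff _ _).2 ⟨?_, ?_⟩
  · exact (Complex.continuous_ofReal.continuousAt.comp ha.1).add
      (continuousAt_const.mul (Complex.continuous_ofReal.continuousAt.comp hb.1))
  · have h1 := (Complex.ofRealCLM.hasFDerivAt.comp _ ha').add
      ((Complex.ofRealCLM.hasFDerivAt.comp _ hb').const_mul Complex.I)
    let L : G →L[ℂ] ℂ :=
      { toFun := fun X ↦ (A X : ℂ) + Complex.I * (B X : ℂ)
        map_add' := fun X Y ↦ by push_cast [map_add]; ring
        -- Complex linearity of `A + iB` is exactly the Cauchy-Riemann equations `hA`, `hB`; a real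
        -- derivative that is complex linear is a complex derivative.
        map_smul' := fun c X ↦ by
          have e : c • X = c.re • X + c.im • (Complex.I • X) := by
            conv_lhs => rw [← Complex.re_add_im c]
            rw [add_smul, mul_smul]
            simp
          rw [e]
          simp only [map_add, map_smul, hA, hB, smul_eq_mul, RingHom.id_apply]
          conv_rhs => rw [← Complex.re_add_im c]
          push_cast
          linear_combination (-(c.im : ℂ) * (B X : ℂ)) * Complex.I_sq
        cont := by fun_prop }
    have h2 : HasFDerivAt _ L _ := hasFDerivAt_of_restrictScalars ℝ h1 (by ext X; simp [L])
    exact h2.differentiableAt.differentiableWithinAt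

/-- Functions `u`, `v` with `d(u + iv) ∘ φ = i d(u + iv)` on `ker η` give a holomorphic function on
the complex leaves of `ker η`. -/
theorem IsHorizontalComplexLeaf.mdifferentiable {G : Type*} [NormedAddCommGroup G]
    [NormedSpace ℂ G] {N : Type*} [TopologicalSpace N] [ChartedSpace G N]
    {φ : EndField E M} {η : OneForm E M} {ι : N → M}
    (hι : IsHorizontalComplexLeaf (G := G) φ η ι) {u v : M → ℝ}
    (hu : MDifferentiable 𝓘(ℝ, E) 𝓘(ℝ, ℝ) u) (hv : MDifferentiable 𝓘(ℝ, E) 𝓘(ℝ, ℝ) v)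
    (huφ : ∀ p x, η p x = 0 → mvfderiv 𝓘(ℝ, E) u p (φ p x) = -mvfderiv 𝓘(ℝ, E) v p x)
    (hvφ : ∀ p x, η p x = 0 → mvfderiv 𝓘(ℝ, E) v p (φ p x) = mvfderiv 𝓘(ℝ, E) u p x) :
    MDifferentiable 𝓘(ℂ, G) 𝓘(ℂ, ℂ) (fun y ↦ (u (ι y) : ℂ) + Complex.I * (v (ι y) : ℂ)) := by
  intro y
  have hd : MDifferentiableAt 𝓘(ℝ, G) 𝓘(ℝ, E) ι y := (hι.smooth y).mdifferentiableAt (by simp)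
  have ht : ∀ X : G, η (ι y) (mfderiv 𝓘(ℝ, G) 𝓘(ℝ, E) ι y X) = 0 := fun X ↦ by
    have : mfderiv 𝓘(ℝ, G) 𝓘(ℝ, E) ι y X ∈ {x | η (ι y) x = 0} := hι.tangent y ▸ ⟨X, rfl⟩
    exact this
  refine mdifferentiableAt_complex_of_cauchyRiemann
    ((hu (ι y)).hasMFDerivAt.comp y hd.hasMFDerivAt)
    ((hv (ι y)).hasMFDerivAt.comp y hd.hasMFDerivAt) (fun X ↦ ?_) (fun X ↦ ?_)
  · exact (congrArg (mvfderiv 𝓘(ℝ, E) u (ι y)) (hι.complex y X)).trans (huφ _ _ (ht X))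
  · exact (congrArg (mvfderiv 𝓘(ℝ, E) v (ι y)) (hι.complex y X)).trans (hvφ _ _ (ht X))

end Consequences

end AlmostContact
end

/-! ### The proposition in dimension `2n + 1`. -/

open AlmostContact in
theorem proposition5p1 {n : ℕ} (hn : 1 ≤ n)
    {M : Type*} [TopologicalSpace M] [ChartedSpace (EuclideanSpace ℝ (Fin (2 * n + 1))) M]
    [IsManifold (𝓡 (2 * n + 1)) ∞ M]
    (φ : EndField (EuclideanSpace ℝ (Fin (2 * n + 1))) M)
    (ξ : VecField (EuclideanSpace ℝ (Fin (2 * n + 1))) M)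
    (η : OneForm (EuclideanSpace ℝ (Fin (2 * n + 1))) M)
    (g : BilinField (EuclideanSpace ℝ (Fin (2 * n + 1))) M)
    (hS : IsSasakiLike φ ξ η g)
    (u v w : M → ℝ)
    (hu : ContMDiff (𝓡 (2 * n + 1)) 𝓘(ℝ, ℝ) ∞ u)
    (hv : ContMDiff (𝓡 (2 * n + 1)) 𝓘(ℝ, ℝ) ∞ v)
    (hw : ContMDiff (𝓡 (2 * n + 1)) 𝓘(ℝ, ℝ) ∞ w) :
    -- the transformed structure is Sasaki-like iff the three equations hold
    (IsSasakiLike φ (confXi ξ w) (confEta η w) (confMetric φ η g u v w) ↔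
      ∀ (p : M) (x : TangentSpace (𝓡 (2 * n + 1)) p),
        mvfderiv (𝓡 (2 * n + 1)) w p (φ p x) = 0 ∧
        mvfderiv (𝓡 (2 * n + 1)) u p x - mvfderiv (𝓡 (2 * n + 1)) v p (φ p x) = 0 ∧
        mvfderiv (𝓡 (2 * n + 1)) u p (φ p x) + mvfderiv (𝓡 (2 * n + 1)) v p x =
          (1 - Real.exp (w p)) * η p x) ∧
    -- the consequences, when the transformed structure is Sasaki-like
    (IsSasakiLike φ (confXi ξ w) (confEta η w) (confMetric φ η g u v w) →
      (∀ p : M, mvfderiv (𝓡 (2 * n + 1)) u p (ξ p) = 0 ∧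
        mvfderiv (𝓡 (2 * n + 1)) v p (ξ p) = 1 - Real.exp (w p)) ∧
      ((∀ p, w p = 0) →
        -- `u` and `v` do not depend on `ξ`
        (∀ p : M, mvfderiv (𝓡 (2 * n + 1)) u p (ξ p) = 0 ∧
          mvfderiv (𝓡 (2 * n + 1)) v p (ξ p) = 0) ∧
        (∀ (γ : ℝ → M) (s : Set ℝ), IsPreconnected s → IsMIntegralCurveOn γ ξ s →
          ∀ t ∈ s, ∀ t' ∈ s, u (γ t) = u (γ t') ∧ v (γ t) = v (γ t')) ∧
        -- `d(u + iv) ∘ φ = i d(u + iv)` on the horizontal distribution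
        (∀ (p : M) (X : TangentSpace (𝓡 (2 * n + 1)) p), η p X = 0 →
          (mvfderiv (𝓡 (2 * n + 1)) u p (φ p X) : ℂ)
              + Complex.I * (mvfderiv (𝓡 (2 * n + 1)) v p (φ p X) : ℂ) =
            Complex.I * ((mvfderiv (𝓡 (2 * n + 1)) u p X : ℂ)
              + Complex.I * (mvfderiv (𝓡 (2 * n + 1)) v p X : ℂ))) ∧
        -- `u + iv` is holomorphic on the complex submanifolds `N` with `TN = ker η`
        (∀ (N : Type*) [TopologicalSpace N] [ChartedSpace (EuclideanSpace ℂ (Fin n)) N]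
          [IsManifold 𝓘(ℂ, EuclideanSpace ℂ (Fin n)) 1 N] (ι : N → M),
          IsHorizontalComplexLeaf (G := EuclideanSpace ℂ (Fin n)) φ η ι →
          MDifferentiable 𝓘(ℂ, EuclideanSpace ℂ (Fin n)) 𝓘(ℂ, ℂ)
            (fun y ↦ (u (ι y) : ℂ) + Complex.I * (v (ι y) : ℂ))) ∧
        -- where `M` is a product of such an `N` with an interval in the direction of `ξ`,
        -- `u + iv` comes from a holomorphic function on `N`
        (∀ (N : Type*) [TopologicalSpace N] [ChartedSpace (EuclideanSpace ℂ (Fin n)) N]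
          [IsManifold 𝓘(ℂ, EuclideanSpace ℂ (Fin n)) 1 N] (s : Set ℝ) (Ψ : N → ℝ → M),
          IsPreconnected s →
          (∀ t ∈ s, IsHorizontalComplexLeaf (G := EuclideanSpace ℂ (Fin n)) φ η
            (fun y ↦ Ψ y t)) →
          (∀ y : N, IsMIntegralCurveOn (Ψ y) ξ s) →
          ∃ f : N → ℂ, MDifferentiable 𝓘(ℂ, EuclideanSpace ℂ (Fin n)) 𝓘(ℂ, ℂ) f ∧
            ∀ y : N, ∀ t ∈ s,
              (u (Ψ y t) : ℂ) + Complex.I * (v (Ψ y t) : ℂ) = f y))) := by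
  -- A linear form on a space of dimension `2n + 1 > 1` has a nonzero kernel; this is where `n ≥ 1`
  -- is used.
  have hker : ∀ p, ∃ Y : TangentSpace (𝓡 (2 * n + 1)) p, η p Y = 0 ∧ Y ≠ 0 := fun p ↦ by
    have hfin : FiniteDimensional ℝ (TangentSpace (𝓡 (2 * n + 1)) p) :=
      inferInstanceAs (FiniteDimensional ℝ (EuclideanSpace ℝ (Fin (2 * n + 1))))
    have hrank : Module.finrank ℝ (TangentSpace (𝓡 (2 * n + 1)) p) = 2 * n + 1 :=
      finrank_euclideanSpace_fin (𝕜 := ℝ)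
    have := LinearMap.ker_ne_bot_of_finrank_lt (f := (η p).toLinearMap)
      (by rw [hrank, Module.finrank_self]; omega)
    obtain ⟨Y, hY, hY0⟩ := Submodule.exists_mem_ne_zero_of_ne_bot this
    exact ⟨Y, hY, hY0⟩
  have hiff := isSasakiLike_conf_iff hS hker hu hv hw
  refine ⟨hiff, fun hS' ↦ ?_⟩
  have H := hiff.1 hS'
  have hξ : ∀ p : M, mvfderiv (𝓡 (2 * n + 1)) u p (ξ p) = 0 ∧
      mvfderiv (𝓡 (2 * n + 1)) v p (ξ p) = 1 - Real.exp (w p) := fun p ↦ by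
    have h1 := (H p (ξ p)).2
    rw [hS.1.phi_xi, hS.1.eta_xi, map_zero, map_zero] at h1
    exact ⟨by linarith [h1.1], by linarith [h1.2]⟩
  refine ⟨hξ, fun hw0 ↦ ?_⟩
  have du : MDifferentiable (𝓡 (2 * n + 1)) 𝓘(ℝ, ℝ) u := hu.mdifferentiable (by simp)
  have dv : MDifferentiable (𝓡 (2 * n + 1)) 𝓘(ℝ, ℝ) v := hv.mdifferentiable (by simp)
  have hξ0 : ∀ p : M, mvfderiv (𝓡 (2 * n + 1)) u p (ξ p) = 0 ∧
      mvfderiv (𝓡 (2 * n + 1)) v p (ξ p) = 0 := fun p ↦ by simpa [hw0 p] using hξ p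
  have hconst : ∀ (γ : ℝ → M) (s : Set ℝ), IsPreconnected s → IsMIntegralCurveOn γ ξ s →
      ∀ t ∈ s, ∀ t' ∈ s, u (γ t) = u (γ t') ∧ v (γ t) = v (γ t') := fun γ s hs hγ t ht t' ht' ↦
    ⟨eq_of_isMIntegralCurveOn du (fun p ↦ (hξ0 p).1) hs hγ ht ht',
      eq_of_isMIntegralCurveOn dv (fun p ↦ (hξ0 p).2) hs hγ ht ht'⟩
  have huφ : ∀ p x, η p x = 0 → mvfderiv (𝓡 (2 * n + 1)) u p (φ p x) =
      -mvfderiv (𝓡 (2 * n + 1)) v p x := fun p x hx ↦ by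
    have := (H p x).2.2
    rw [hx, mul_zero] at this
    linarith
  have hvφ : ∀ p x, η p x = 0 → mvfderiv (𝓡 (2 * n + 1)) v p (φ p x) =
      mvfderiv (𝓡 (2 * n + 1)) u p x := fun p x _ ↦ by linarith [(H p x).2.1]
  refine ⟨hξ0, hconst, fun p X hX ↦ ?_, fun N _ _ _ ι hι ↦ hι.mdifferentiable du dv huφ hvφ,
    fun N _ _ _ s Ψ hs hΨ hγ ↦ ?_⟩
  · rw [huφ p X hX, hvφ p X hX]
    push_cast
    linear_combination (-(mvfderiv (𝓡 (2 * n + 1)) v p X : ℂ)) * Complex.I_sq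
  -- Any slice `t₀ ∈ s` provides the function on `N`, by constancy along the curves; for empty `s`
  -- any holomorphic function will do.
  · rcases s.eq_empty_or_nonempty with rfl | ⟨t₀, ht₀⟩
    · exact ⟨fun _ ↦ 0, mdifferentiable_const, fun y t ht ↦ ht.elim⟩
    · refine ⟨_, (hΨ t₀ ht₀).mdifferentiable du dv huφ hvφ, fun y t ht ↦ ?_⟩
      obtain ⟨h1, h2⟩ := hconst (Ψ y) s hs (hγ y) t ht t₀ ht₀
      rw [h1, h2]
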